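/- Let $H$ be a complex (not necessarily separable) Hilbert space with $\dim H \ge 3$, and let $P(H)$ denote the set of all orthogonal projections on $H$, i.e. the bounded operators $P$ on $H$ with $P = P^* = P^2$; write $P^\perp = I - P$. Let $\varphi : P(H) \to P(H)$ be a bijection that preserves commutativity in both directions, i.e. for all $P, Q \in P(H)$, $$PQ = QP \iff \varphi(P)\varphi(Q) = \varphi(Q)\varphi(P).$$ Then there exists a unitary or antiunitary operator $U : H \to H$ (a linear, respectively conjugate-linear, isometric bijection, so that $U^* = U^{-1}$) such that $$\varphi(P) \in \{\, U P U^*,\; U P^\perp U^* \,\} \qquad \text{for every } P \in P(H).$$ -/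

import Mathlib

/-- The orthogonal projections on `H`: bounded operators with `P * P = P` and `P* = P`. -/
abbrev Proj (H : Type*) [NormedAddCommGroup H] [InnerProductSpace ℂ H] [CompleteSpace H] :
    Type _ :=
  {P : H →L[ℂ] H // IsStarProjection P}

/-- The ortho-complement `I - P` of a projection `P`. -/
def Proj.perp {H : Type*} [NormedAddCommGroup H] [InnerProductSpace ℂ H] [CompleteSpace H]
    (P : Proj H) : Proj H :=
  ⟨1 - P.1, P.2.one_sub⟩

/-- The operator `U A U*`, where `U` is a bijective linear (unitary) or conjugate-linear
(antiunitary) isometry of `H`. In both cases `U*` is the inverse of `U`: see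
`inner_unitary_adjoint` and `inner_antiunitary_adjoint`. -/
noncomputable def isometryConj {H : Type*} [NormedAddCommGroup H] [InnerProductSpace ℂ H]
    {σ τ : ℂ →+* ℂ} [RingHomInvPair σ τ] [RingHomInvPair τ σ]
    (U : H ≃ₛₗᵢ[σ] H) (A : H →L[ℂ] H) : H →L[ℂ] H :=
  (U.toContinuousLinearEquiv : H →SL[σ] H).comp
    (A.comp (U.symm.toContinuousLinearEquiv : H →SL[τ] H))

theorem isometryConj_apply {H : Type*} [NormedAddCommGroup H] [InnerProductSpace ℂ H]
    {σ τ : ℂ →+* ℂ} [RingHomInvPair σ τ] [RingHomInvPair τ σ]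
    (U : H ≃ₛₗᵢ[σ] H) (A : H →L[ℂ] H) (x : H) :
    isometryConj U A x = U (A (U.symm x)) := rfl

/-- The inverse of a unitary is its adjoint. -/
theorem inner_unitary_adjoint {H : Type*} [NormedAddCommGroup H] [InnerProductSpace ℂ H]
    (U : H ≃ₗᵢ[ℂ] H) (x y : H) : inner ℂ (U x) y = inner ℂ x (U.symm y) := by
  rw [← U.inner_map_map x (U.symm y), U.apply_symm_apply]

/-- A conjugate-linear isometry conjugates the inner product. -/
theorem inner_antiunitary_map_map {H : Type*} [NormedAddCommGroup H] [InnerProductSpace ℂ H]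
    (U : H ≃ₗᵢ⋆[ℂ] H) (x y : H) : inner ℂ (U x) (U y) = inner ℂ y x := by
  have hI : ∀ z : H, (Complex.I : ℂ) • U z = U (-(Complex.I • z)) := by
    intro z
    rw [map_neg, map_smulₛₗ]
    simp
  rw [inner_eq_sum_norm_sq_div_four (𝕜 := ℂ) (U x) (U y),
    inner_eq_sum_norm_sq_div_four (𝕜 := ℂ) y x]
  simp only [RCLike.I_to_complex, hI, ← map_add, ← map_sub, U.norm_map]
  have h1 : ‖x - -(Complex.I • y)‖ = ‖y - Complex.I • x‖ := by
    have : x - -(Complex.I • y) = Complex.I • (y - Complex.I • x) := by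
      rw [smul_sub, smul_smul, Complex.I_mul_I]; module
    rw [this, norm_smul]; simp
  have h2 : ‖x + -(Complex.I • y)‖ = ‖y + Complex.I • x‖ := by
    have : x + -(Complex.I • y) = (-Complex.I) • (y + Complex.I • x) := by
      rw [smul_add, smul_smul, neg_mul, Complex.I_mul_I]; module
    rw [this, norm_smul]; simp
  rw [h1, h2, add_comm x y, norm_sub_rev x y]

/-- The inverse of an antiunitary is its (conjugate-linear) adjoint. -/
theorem inner_antiunitary_adjoint {H : Type*} [NormedAddCommGroup H] [InnerProductSpace ℂ H]
    (U : H ≃ₗᵢ⋆[ℂ] H) (x y : H) : inner ℂ (U x) y = inner ℂ (U.symm y) x := by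
  rw [← inner_antiunitary_map_map U x (U.symm y), U.apply_symm_apply]

/-! A projection commutes with a rank-one projection exactly when it kills or fixes the line. Hence
a projection is determined, up to complement, by the rank-one projections commuting with it, and it
suffices to understand `φ` on lines.

Lines are first recognised by commutativity alone. Under the double commutant closure, a noncentral
`P` has the exchange property `¬ ExchangeFails P` iff `P` or `1 - P` has rank one
(`not_exchangeFails_line`, `exists_line_of_not_exchangeFails`). So `φ` sends lines to lines up to
complement. In dimension at least three, lines are orthogonal iff their projections commute and have
different commutants, so the induced map `g` of vectors preserves orthogonality both ways.

It remains to prove Uhlhorn's theorem for `g`. Fix a unit vector `a` and normalise `g a` to a unit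
vector `b`. In the affine charts `a + v` and `b + F v`, with `v ⟂ a` and `F v ⟂ b`, orthogonality
reads `⟪v, v'⟫ = -1`. As `F v` is also a nonzero multiple of `g v`, the map `F` preserves the values
`0` and `-1` of the inner product. This rigidity makes `F` a linear or conjugate-linear isometry
(`PairingPreserving.exists_semilinear`), which extends to `H` by `a ↦ b`. -/

/-! ### Commuting projections -/

/-! ### Idempotents determined by their killed or fixed vectors. -/

section Idempotent

variable {E : Type*} [AddCommGroup E] [Module ℂ E]

/-- A linear map for which every vector of a submodule is either killed or fixed is `0` or the
identity on that submodule. -/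
theorem killed_or_fixed_on {R : E →ₗ[ℂ] E} {M : Submodule ℂ E}
    (h : ∀ y ∈ M, R y = 0 ∨ R y = y) : (∀ y ∈ M, R y = 0) ∨ ∀ y ∈ M, R y = y := by
  by_contra! hc
  obtain ⟨⟨y, hy, hy0⟩, z, hz, hz1⟩ := hc
  have hy1 : R y = y := (h y hy).resolve_left hy0
  have hz0 : R z = 0 := (h z hz).resolve_right hz1
  rcases h (y + z) (M.add_mem hy hz) with h1 | h1 <;> rw [map_add, hy1, hz0, add_zero] at h1
  · exact hy0 (by rw [hy1, h1])
  · exact hz1 (by rw [hz0]; exact (by simpa using h1 : z = 0).symm)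

theorem exists_scalar_on {R : E →ₗ[ℂ] E} {M : Submodule ℂ E}
    (h : ∀ y ∈ M, R y = 0 ∨ R y = y) : ∃ c : ℂ, ∀ y ∈ M, R y = c • y := by
  rcases killed_or_fixed_on h with h | h
  · exact ⟨0, fun y hy => by rw [h y hy, zero_smul]⟩
  · exact ⟨1, fun y hy => by rw [h y hy, one_smul]⟩

/-- If every vector killed or fixed by the idempotent `P` is killed or fixed by `S`, then `S` is
one of `0`, `1`, `P`, `1 - P`. -/
theorem eq_of_killed_or_fixed_imp {P S : E →ₗ[ℂ] E} (hP : ∀ x, P (P x) = P x)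
    (h : ∀ x, (P x = 0 ∨ P x = x) → (S x = 0 ∨ S x = x)) :
    (∀ x, S x = 0) ∨ (∀ x, S x = x) ∨ (∀ x, S x = P x) ∨ ∀ x, S x = x - P x := by
  have hr : ∀ x, P x ∈ LinearMap.range P := fun x => ⟨x, rfl⟩
  have hk : ∀ x, x - P x ∈ LinearMap.ker P := fun x => by simp [hP]
  have hs : ∀ x, S x = S (P x) + S (x - P x) := fun x => by rw [← map_add]; simp
  have h1 := killed_or_fixed_on (R := S) (M := LinearMap.range P)
    (by rintro _ ⟨x, rfl⟩; exact h _ (Or.inr (hP x)))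
  have h2 := killed_or_fixed_on (R := S) (M := LinearMap.ker P) (fun y hy => h _ (Or.inl hy))
  rcases h1 with h1 | h1 <;> rcases h2 with h2 | h2
  · exact Or.inl fun x => by rw [hs, h1 _ (hr x), h2 _ (hk x), add_zero]
  · exact Or.inr <| Or.inr <| Or.inr fun x => by rw [hs, h1 _ (hr x), h2 _ (hk x), zero_add]
  · exact Or.inr <| Or.inr <| Or.inl fun x => by rw [hs, h1 _ (hr x), h2 _ (hk x), add_zero]
  · exact Or.inr <| Or.inl fun x => by rw [hs, h1 _ (hr x), h2 _ (hk x)]; simp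

/-- Two idempotents with the same killed or fixed vectors agree up to complementation. -/
theorem eq_or_eq_compl_of_killed_or_fixed_iff {P S : E →ₗ[ℂ] E} (hP : ∀ x, P (P x) = P x)
    (hS : ∀ x, S (S x) = S x) (h : ∀ x, (P x = 0 ∨ P x = x) ↔ (S x = 0 ∨ S x = x)) :
    (∀ x, S x = P x) ∨ ∀ x, S x = x - P x := by
  -- A trivial `S` kills or fixes everything, so the converse implication forces `P` to be `0` or
  -- `1` as well.
  rcases eq_of_killed_or_fixed_imp hP fun x => (h x).1 with h0 | h1 | h2 | h3
  · rcases eq_of_killed_or_fixed_imp hS fun x => (h x).2 with k | k | k | k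
    · exact Or.inl fun x => by rw [h0, k]
    · exact Or.inr fun x => by rw [h0, k, sub_self]
    · exact Or.inl fun x => by rw [k]
    · exact Or.inr fun x => by rw [k]; simp
  · rcases eq_of_killed_or_fixed_imp hS fun x => (h x).2 with k | k | k | k
    · exact Or.inr fun x => by rw [h1, k, sub_zero]
    · exact Or.inl fun x => by rw [h1, k]
    · exact Or.inl fun x => by rw [k]
    · exact Or.inr fun x => by rw [k]; simp
  · exact Or.inl h2
  · exact Or.inr h3

end Idempotent

/-! ### Rank-one projections characterised by commutativity. -/

section Projections

variable {H : Type*} [NormedAddCommGroup H] [InnerProductSpace ℂ H] [CompleteSpace H]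

namespace Proj

theorem apply_apply (P : Proj H) (x : H) : P.1 (P.1 x) = P.1 x :=
  DFunLike.congr_fun P.2.isIdempotentElem x

theorem inner_apply_left (P : Proj H) (x y : H) : inner ℂ (P.1 x) y = inner ℂ x (P.1 y) :=
  (ContinuousLinearMap.isSelfAdjoint_iff_isSymmetric.1 P.2.isSelfAdjoint) x y

theorem commute_perp {P S : Proj H} : Commute S.1 P.perp.1 ↔ Commute S.1 P.1 := by
  constructor
  · intro h
    have := (Commute.one_right S.1).sub_right h
    simpa [perp] using this
  · exact fun h => (Commute.one_right S.1).sub_right h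

/-- The projection onto the line spanned by `x`. -/
noncomputable def line (x : H) : Proj H :=
  ⟨(ℂ ∙ x).starProjection, isStarProjection_starProjection⟩

theorem line_apply (x z : H) : (line x).1 z = (inner ℂ x z / ((‖x‖ : ℂ) ^ 2)) • x := by
  have := Submodule.starProjection_singleton ℂ (v := x) z
  simpa [line] using this

theorem line_apply_self (x : H) : (line x).1 x = x :=
  Submodule.starProjection_eq_self_iff.2 (Submodule.mem_span_singleton_self x)

theorem line_apply_eq_self_iff {x z : H} : (line x).1 z = z ↔ ∃ c : ℂ, z = c • x := by
  rw [line, Submodule.starProjection_eq_self_iff, Submodule.mem_span_singleton]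
  simp [eq_comm]

theorem line_apply_eq_zero_iff {x z : H} : (line x).1 z = 0 ↔ inner ℂ x z = 0 := by
  rw [line_apply]
  by_cases hx : x = 0
  · simp [hx]
  · simp [hx]

/-- A projection commutes with the projection onto a line iff it kills or fixes that line. -/
theorem commute_line_iff {P : Proj H} {x : H} :
    Commute P.1 (line x).1 ↔ P.1 x = 0 ∨ P.1 x = x := by
  constructor
  · intro h
    have h1 : P.1 x = (line x).1 (P.1 x) := by
      conv_lhs => rw [← line_apply_self x]
      exact DFunLike.congr_fun h.eq x
    obtain ⟨c, hc⟩ := line_apply_eq_self_iff.1 h1.symm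
    have h2 : c • (c • x - x) = 0 := by
      have := P.apply_apply x
      rw [hc, map_smul, hc] at this
      rw [smul_sub, this, sub_self]
    rcases smul_eq_zero.1 h2 with h3 | h3
    · exact Or.inl (by rw [hc, h3, zero_smul])
    · exact Or.inr (by rw [hc]; exact sub_eq_zero.1 h3)
  · rintro (h | h)
    · ext z
      change P.1 ((line x).1 z) = (line x).1 (P.1 z)
      rw [line_apply, line_apply, map_smul, h, ← inner_apply_left, h]
      simp
    · ext z
      change P.1 ((line x).1 z) = (line x).1 (P.1 z)
      rw [line_apply, line_apply, map_smul, h, ← inner_apply_left, h]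

/-- Two projections are equivalent when they commute with the same projections. -/
def SameCommutant (P Q : Proj H) : Prop :=
  ∀ S : Proj H, Commute S.1 P.1 ↔ Commute S.1 Q.1

theorem SameCommutant.refl (P : Proj H) : SameCommutant P P := fun _ => Iff.rfl

theorem SameCommutant.symm {P Q : Proj H} (h : SameCommutant P Q) : SameCommutant Q P :=
  fun S => (h S).symm

theorem SameCommutant.trans {P Q R : Proj H} (h : SameCommutant P Q) (h' : SameCommutant Q R) :
    SameCommutant P R := fun S => (h S).trans (h' S)

theorem sameCommutant_perp (P : Proj H) : SameCommutant P.perp P := fun _ => commute_perp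

/-- Failure of the exchange property of the double commutant at `P`: there are `Q` commuting
with `P` and `R` in the double commutant of `{P, Q}` but not of `Q`, such that `P` is not in the
double commutant of `{Q, R}`. -/
def ExchangeFails (P : Proj H) : Prop :=
  ∃ Q R : Proj H, Commute Q.1 P.1 ∧
    (∀ S : Proj H, Commute S.1 P.1 → Commute S.1 Q.1 → Commute S.1 R.1) ∧
    (∃ S : Proj H, Commute S.1 Q.1 ∧ ¬ Commute S.1 R.1) ∧
    ∃ S : Proj H, Commute S.1 Q.1 ∧ Commute S.1 R.1 ∧ ¬ Commute S.1 P.1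

theorem perp_apply (P : Proj H) (x : H) : P.perp.1 x = x - P.1 x := rfl

/-- The line of `x` splits only one of the two eigenspaces of `Q`, so it adds just one dimension to
the algebra generated by `Q` and `1`. Any `R` in the larger algebra but outside the smaller one
therefore recovers `line x`. -/
theorem not_exchangeFails_line (x : H) : ¬ ExchangeFails (line x) := by
  rintro ⟨Q, R, hQP, hR, ⟨S₁, hS₁Q, hS₁R⟩, S₂, hS₂Q, hS₂R, hS₂P⟩
  wlog hQ : Q.1 x = x generalizing Q
  · have hx := (commute_line_iff.1 hQP).resolve_right hQ
    refine this Q.perp ?_ ?_ (commute_perp.2 hS₁Q) (commute_perp.2 hS₂Q) ?_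
    · exact (commute_perp.2 hQP.symm).symm
    · exact fun S h1 h2 => hR S h1 (commute_perp.1 h2)
    · rw [perp_apply, hx, sub_zero]
  have key : ∀ y, (line x).1 y = 0 → (Q.1 y = 0 ∨ Q.1 y = y) → R.1 y = 0 ∨ R.1 y = y := by
    intro y hy hQy
    refine commute_line_iff.1 (hR (line y) ?_ (commute_line_iff.2 hQy).symm).symm
    exact (commute_line_iff.2 (Or.inl hy)).symm
  have hPQ : ∀ z, (line x).1 (Q.1 z) = (line x).1 z := fun z => by
    rw [line_apply, ← inner_apply_left, hQ, ← line_apply]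
  -- `R` is scalar on each of three blocks: the line of `x`, the rest of the range of `Q`, and the
  -- kernel of `Q`.
  obtain ⟨α, hα⟩ : ∃ α : ℂ, R.1 x = α • x := by
    rcases commute_line_iff.1 (hR (line x) (Commute.refl _) hQP.symm).symm with h | h
    · exact ⟨0, by simp [h]⟩
    · exact ⟨1, by simp [h]⟩
  obtain ⟨β, hβ⟩ := exists_scalar_on (R := (R.1 : H →ₗ[ℂ] H))
    (M := LinearMap.ker (line x).1.toLinearMap ⊓ LinearMap.ker Q.perp.1.toLinearMap)
    (fun y hy => key y hy.1 (Or.inr (by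
      have := hy.2; simp [perp_apply, sub_eq_zero] at this; exact this.symm)))
  obtain ⟨γ, hγ⟩ := exists_scalar_on (R := (R.1 : H →ₗ[ℂ] H))
    (M := LinearMap.ker Q.1.toLinearMap)
    (fun y hy => key y (by rw [← hPQ, show Q.1 y = 0 from hy, map_zero]) (Or.inl hy))
  have hRz : R.1 = α • (line x).1 + β • (Q.1 - (line x).1) + γ • (1 - Q.1) := by
    ext z
    have h1 : R.1 ((line x).1 z) = α • (line x).1 z := by
      rw [line_apply, map_smul, hα, smul_comm]
    have h2 : R.1 (Q.1 z - (line x).1 z) = β • (Q.1 z - (line x).1 z) := by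
      refine hβ _ ⟨?_, ?_⟩
      · simp [hPQ, apply_apply]
      · have : Q.1 ((line x).1 z) = (line x).1 z := by rw [line_apply, map_smul, hQ]
        simp [perp_apply, apply_apply, this]
    have h3 : R.1 (z - Q.1 z) = γ • (z - Q.1 z) := hγ _ (by simp [apply_apply])
    have : z = (line x).1 z + (Q.1 z - (line x).1 z) + (z - Q.1 z) := by abel
    conv_lhs => rw [this, map_add, map_add, h1, h2, h3]
    rfl
  -- If `α = β`, then `R` lies in the span of `Q` and `1`, contradicting `S₁`; otherwise `line x` is
  -- a combination of `R`, `Q` and `1`, contradicting `S₂`.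
  by_cases hαβ : α = β
  · refine hS₁R ?_
    have : R.1 = α • Q.1 + γ • (1 - Q.1) := by rw [hRz, ← hαβ, ← smul_add]; simp
    rw [this]
    exact (hS₁Q.smul_right _).add_right (((Commute.one_right _).sub_right hS₁Q).smul_right _)
  · refine hS₂P ?_
    have : (line x).1 = (α - β)⁻¹ • (R.1 - β • Q.1 - γ • (1 - Q.1)) := by
      rw [eq_inv_smul_iff₀ (sub_ne_zero.2 hαβ), hRz]
      module
    rw [this]
    exact ((hS₂R.sub_right (hS₂Q.smul_right _)).sub_right
      (((Commute.one_right _).sub_right hS₂Q).smul_right _)).smul_right _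

/-- A projection that fixes `x` and no nonzero vector orthogonal to `x` is the projection onto
the line of `x`. -/
theorem eq_line {P : Proj H} {x : H} (hx : P.1 x = x)
    (h : ∀ y, inner ℂ x y = 0 → P.1 y = y → y = 0) : P = line x := by
  have key : ∀ z, (line x).1 z = 0 → P.1 z = 0 := fun z hz => by
    refine h _ ?_ (P.apply_apply z)
    rw [← inner_apply_left, hx]
    exact line_apply_eq_zero_iff.1 hz
  refine Subtype.ext (ContinuousLinearMap.ext fun z => ?_)
  have h1 := key (z - (line x).1 z) (by rw [map_sub, apply_apply, sub_self])
  rw [map_sub, sub_eq_zero] at h1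
  rw [h1, line_apply, map_smul, hx]

/-- A noncentral `P` has nonzero range and kernel. If neither is a line, each contains two
orthogonal nonzero vectors, which is room enough to violate exchange. -/
theorem exists_line_of_not_exchangeFails {P : Proj H} (hP : ∃ S : Proj H, ¬ Commute S.1 P.1)
    (h : ¬ ExchangeFails P) : ∃ x, x ≠ 0 ∧ SameCommutant P (line x) := by
  obtain ⟨x, hx0, hx⟩ : ∃ x, x ≠ 0 ∧ P.1 x = x := by
    by_contra! hc
    have : P.1 = 0 := by
      ext z
      by_contra h0
      exact hc (P.1 z) h0 (P.apply_apply z)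
    obtain ⟨S, hS⟩ := hP
    exact hS (by rw [this]; exact Commute.zero_right _)
  obtain ⟨y, hy0, hy⟩ : ∃ y, y ≠ 0 ∧ P.1 y = 0 := by
    by_contra! hc
    have : P.1 = 1 := by
      ext z
      by_contra h0
      exact hc (z - P.1 z) (sub_ne_zero.2 (Ne.symm h0)) (by rw [map_sub, P.apply_apply, sub_self])
    obtain ⟨S, hS⟩ := hP
    exact hS (by rw [this]; exact Commute.one_right _)
  by_cases hx' : ∀ z, inner ℂ x z = 0 → P.1 z = z → z = 0
  · exact ⟨x, hx0, by rw [eq_line hx hx']; exact SameCommutant.refl _⟩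
  by_cases hy' : ∀ z, inner ℂ y z = 0 → P.1 z = 0 → z = 0
  · refine ⟨y, hy0, ?_⟩
    rw [← eq_line (P := P.perp) (x := y) (by simp [perp_apply, hy])
      (fun z h1 h2 => hy' z h1 (by simpa [perp_apply] using h2))]
    exact (sameCommutant_perp P).symm
  exfalso
  push Not at hx' hy'
  obtain ⟨x', hxx, hx'1, hx'0⟩ := hx'
  obtain ⟨y', hyy, hy'1, hy'0⟩ := hy'
  have orth : ∀ u v, P.1 u = u → P.1 v = 0 → inner ℂ u v = 0 := fun u v hu hv => by
    rw [← hu, inner_apply_left, hv, inner_zero_right]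
  have hPx : P.1 * (line x).1 = (line x).1 := by
    ext z
    change P.1 ((line x).1 z) = _
    rw [line_apply, map_smul, hx]
  have hPy : P.1 * (line y).1 = 0 := by
    ext z
    change P.1 ((line y).1 z) = _
    rw [line_apply, map_smul, hy, smul_zero]; rfl
  have hxy : (line x).1 * (line y).1 = 0 := by
    ext z
    change (line x).1 ((line y).1 z) = _
    rw [line_apply y, map_smul, line_apply_eq_zero_iff.2 (orth x y hx hy), smul_zero]; rfl
  have hcx : Commute P.1 (line x).1 := commute_line_iff.2 (Or.inr hx)
  have hcy : Commute P.1 (line y).1 := commute_line_iff.2 (Or.inl hy)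
  -- Take `Q = line x + line y` and `R = P * Q = line x`. The line of `x + y` separates `R` from
  -- `Q`; the line of `x' + y'` is killed by both `Q` and `R` but not respected by `P`.
  refine h ⟨⟨_, (line x).2.add (line y).2 hxy⟩, line x, (hcx.add_right hcy).symm, ?_,
    ⟨line (x + y), ?_, ?_⟩, line (x' + y'), ?_, ?_, ?_⟩
  · intro S h1 h2
    have := h1.mul_right h2
    rwa [mul_add, hPx, hPy, add_zero] at this
  · refine (commute_line_iff.2 (Or.inr ?_)).symm
    simp [line_apply_self, line_apply_eq_zero_iff.2 (orth x y hx hy),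
      line_apply_eq_zero_iff.2 (inner_eq_zero_symm.1 (orth x y hx hy))]
  · intro hc
    have := commute_line_iff.1 hc.symm
    simp [line_apply_self, line_apply_eq_zero_iff.2 (orth x y hx hy), hx0, hy0] at this
  · refine (commute_line_iff.2 (Or.inl ?_)).symm
    simp [line_apply_eq_zero_iff.2 (orth x y' hx hy'1), line_apply_eq_zero_iff.2 hxx,
      line_apply_eq_zero_iff.2 hyy,
      line_apply_eq_zero_iff.2 (inner_eq_zero_symm.1 (orth x' y hx'1 hy))]
  · refine (commute_line_iff.2 (Or.inl ?_)).symm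
    simp [line_apply_eq_zero_iff.2 (orth x y' hx hy'1), line_apply_eq_zero_iff.2 hxx]
  · intro hc
    have := commute_line_iff.1 hc.symm
    simp [hx'1, hy'1, hx'0, hy'0] at this

/-- Two nonzero vectors are orthogonal iff their lines commute and are inequivalent. -/
theorem inner_eq_zero_iff_commute_line (hdim : ∀ x y : H, ∃ w, w ≠ 0 ∧ inner ℂ x w = 0 ∧
    inner ℂ y w = 0) {x y : H} (hy : y ≠ 0) :
    inner ℂ x y = 0 ↔ Commute (line x).1 (line y).1 ∧ ¬ SameCommutant (line x) (line y) := by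
  constructor
  · refine fun h => ⟨commute_line_iff.2 (Or.inl (line_apply_eq_zero_iff.2 h)), fun hs => ?_⟩
    obtain ⟨w, hw, hxw, hyw⟩ := hdim x y
    -- The vector `w + y` is orthogonal to `x` but neither in nor orthogonal to the line of `y`. In
    -- dimension two orthogonal lines are complementary and share their commutant.
    have h1 : Commute (line (w + y)).1 (line x).1 := by
      refine (commute_line_iff.2 (Or.inl (line_apply_eq_zero_iff.2 ?_))).symm
      rw [inner_add_right, hxw, h, add_zero]
    have h2 := commute_line_iff.1 ((hs _).1 h1).symm
    simp [line_apply_eq_zero_iff.2 hyw, line_apply_self, hy, hw] at h2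
  · rintro ⟨hc, hs⟩
    rcases commute_line_iff.1 hc with h | h
    · exact line_apply_eq_zero_iff.1 h
    · obtain ⟨c, rfl⟩ := line_apply_eq_self_iff.1 h
      have hc0 : c ≠ 0 := fun h0 => hy (by rw [h0, zero_smul])
      refine absurd ?_ hs
      have : line (c • x) = line x := Subtype.ext <| by
        simp only [line]
        congr 1
        exact Submodule.span_singleton_smul_eq (IsUnit.mk0 c hc0) x
      rw [this]
      exact SameCommutant.refl _

theorem exists_smul_of_sameCommutant_line (hdim : ∀ x y : H, ∃ w, w ≠ 0 ∧ inner ℂ x w = 0 ∧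
    inner ℂ y w = 0) {x y : H} (hy : y ≠ 0)
    (h : SameCommutant (line x) (line y)) : ∃ c : ℂ, y = c • x := by
  have hc : Commute (line x).1 (line y).1 := (h _).1 (Commute.refl _)
  rcases commute_line_iff.1 hc with h1 | h1
  · exact absurd h ((inner_eq_zero_iff_commute_line hdim hy).1
      (line_apply_eq_zero_iff.1 h1)).2
  · exact line_apply_eq_self_iff.1 h1

theorem exists_not_commute_line (hdim : ∀ x y : H, ∃ w, w ≠ 0 ∧ inner ℂ x w = 0 ∧
    inner ℂ y w = 0) {x : H} (hx : x ≠ 0) : ∃ S : Proj H, ¬ Commute S.1 (line x).1 := by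
  obtain ⟨w, hw, hxw, -⟩ := hdim x x
  refine ⟨line (x + w), fun hc => ?_⟩
  have := commute_line_iff.1 hc.symm
  simp [line_apply_self, line_apply_eq_zero_iff.2 hxw, hx, hw] at this

theorem commute_line_zero (S : Proj H) : Commute S.1 (line (0 : H)).1 :=
  commute_line_iff.2 (Or.inl (map_zero _))

end Proj

theorem exists_ne_zero_orthogonal {H : Type*} [NormedAddCommGroup H] [InnerProductSpace ℂ H]
    (hdim : 3 ≤ Module.rank ℂ H) (x y : H) :
    ∃ w : H, w ≠ 0 ∧ inner ℂ x w = 0 ∧ inner ℂ y w = 0 := by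
  classical
  by_contra! hc
  have h1 : (Submodule.span ℂ ({x, y} : Set H))ᗮ = ⊥ := by
    rw [eq_bot_iff]
    intro w hw
    by_contra h0
    rw [Submodule.mem_orthogonal] at hw
    exact hc w h0 (hw x (Submodule.subset_span (by simp))) (hw y (Submodule.subset_span (by simp)))
  have : FiniteDimensional ℂ (Submodule.span ℂ ({x, y} : Set H)) :=
    FiniteDimensional.span_of_finite ℂ (Set.toFinite _)
  rw [Submodule.orthogonal_eq_bot_iff] at h1
  have h2 : Module.rank ℂ H ≤ 2 := by
    rw [← rank_top ℂ H, ← h1]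
    have := rank_span_finset_le (R := ℂ) ({x, y} : Finset H)
    rw [Finset.coe_pair] at this
    exact this.trans (by exact_mod_cast Finset.card_le_two)
  exact absurd (hdim.trans h2) (by norm_num)

/-- A commutativity-preserving bijection of the projections induces a map of vectors preserving
orthogonality in both directions and onto up to scalars. -/
theorem exists_orthogonality_preserving (hdim : ∀ x y : H, ∃ w, w ≠ 0 ∧ inner ℂ x w = 0 ∧
    inner ℂ y w = 0) {φ : Proj H → Proj H} (hsurj : Function.Surjective φ)
    (hcomm : ∀ P Q : Proj H, Commute P.1 Q.1 ↔ Commute (φ P).1 (φ Q).1) :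
    ∃ g : H → H, (∀ x, Proj.SameCommutant (φ (Proj.line x)) (Proj.line (g x))) ∧
      (∀ x y, inner ℂ x y = 0 ↔ inner ℂ (g x) (g y) = 0) ∧
      ∀ y, ∃ x, ∃ c : ℂ, y = c • g x := by
  -- Both relations quantify over projections and mention only commutation, so surjectivity of `φ`
  -- transports them.
  have hsame : ∀ P Q, Proj.SameCommutant P Q ↔ Proj.SameCommutant (φ P) (φ Q) := fun P Q => by
    refine Iff.symm (hsurj.forall.trans (forall_congr' fun S => ?_))
    rw [← hcomm, ← hcomm]
  have hex : ∀ P, Proj.ExchangeFails P ↔ Proj.ExchangeFails (φ P) := fun P => by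
    refine Iff.symm (hsurj.exists.trans (exists_congr fun Q => hsurj.exists.trans
      (exists_congr fun R => and_congr (hcomm _ _).symm (and_congr (hsurj.forall.trans
        (forall_congr' fun S => ?_)) (and_congr (hsurj.exists.trans (exists_congr fun S => ?_))
          (hsurj.exists.trans (exists_congr fun S => ?_)))))))
    all_goals simp only [← hcomm]
  have hg : ∀ x : H, ∃ y, (x = 0 ↔ y = 0) ∧
      Proj.SameCommutant (φ (Proj.line x)) (Proj.line y) := by
    intro x
    by_cases hx : x = 0
    · refine ⟨0, by simp [hx], fun S => ?_⟩
      obtain ⟨S, rfl⟩ := hsurj S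
      rw [← hcomm, hx]
      simp [Proj.commute_line_zero]
    · obtain ⟨S, hS⟩ := Proj.exists_not_commute_line hdim hx
      obtain ⟨y, hy, h⟩ := Proj.exists_line_of_not_exchangeFails (P := φ (Proj.line x))
        ⟨φ S, by rwa [← hcomm]⟩ (by rw [← hex]; exact Proj.not_exchangeFails_line x)
      exact ⟨y, by simp [hx, hy], h⟩
  choose g hg0 hg using hg
  refine ⟨g, hg, fun x y => ?_, fun y => ?_⟩
  · by_cases hx : x = 0
    · rw [(hg0 x).1 hx, hx]; simp
    by_cases hy : y = 0
    · rw [(hg0 y).1 hy, hy]; simp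
    rw [Proj.inner_eq_zero_iff_commute_line hdim hy,
      Proj.inner_eq_zero_iff_commute_line hdim (mt (hg0 y).2 hy),
      hcomm, hsame]
    refine and_congr ?_ (not_congr ⟨fun h => ?_, fun h => ?_⟩)
    · rw [hg y, Commute.symm_iff, hg x, Commute.symm_iff]
    · exact ((hg x).symm.trans h).trans (hg y)
    · exact ((hg x).trans h).trans (hg y).symm
  · by_cases hy : y = 0
    · exact ⟨0, 0, by simp [hy]⟩
    obtain ⟨P, hP⟩ := hsurj (Proj.line y)
    obtain ⟨S, hS⟩ := Proj.exists_not_commute_line hdim hy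
    obtain ⟨S, rfl⟩ := hsurj S
    obtain ⟨x, hx, h⟩ := Proj.exists_line_of_not_exchangeFails (P := P)
      ⟨S, by rwa [hcomm, hP]⟩ (by rw [hex, hP]; exact Proj.not_exchangeFails_line y)
    refine ⟨x, Proj.exists_smul_of_sameCommutant_line hdim hy ?_⟩
    have := ((hsame _ _).1 h).trans (hg x)
    rw [hP] at this
    exact this.symm

end Projections
/-! ### Orthogonality-preserving maps of vectors -/

open ComplexConjugate in
/-- A map of `ℂ` preserving the relations `⟪p, q⟫ = 0` and `⟪p, q⟫ = -1` between pairs in `ℂ²`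
is the identity or the conjugation. -/
theorem exists_ringHom_of_pairing_preserving {σ : ℂ → ℂ} (h0 : σ 0 = 0) (h1 : σ 1 = 1)
    (hn : σ (-1) = -1)
    (hz : ∀ α β γ δ, conj α * γ + conj β * δ = 0 →
      conj (σ α) * σ γ + conj (σ β) * σ δ = 0)
    (hm : ∀ α β γ δ, conj α * γ + conj β * δ = -1 →
      conj (σ α) * σ γ + conj (σ β) * σ δ = -1) :
    ∃ s : ℂ →+* ℂ, (s = RingHom.id ℂ ∨ s = starRingEnd ℂ) ∧ ∀ c, σ c = s c := by
  have hA : ∀ β δ, σ (-(β * δ)) = -(conj (σ (conj β)) * σ δ) := fun β δ => by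
    -- Orthogonality of `(1, conj β)` and `(-βδ, δ)` encodes multiplication; `δ = -1` then shows
    -- that `σ` commutes with conjugation.
    have := hz 1 (conj β) (-(β * δ)) δ (by simp)
    rw [h1, map_one, one_mul] at this
    exact eq_neg_of_add_eq_zero_left this
  have hτ : ∀ β, conj (σ (conj β)) = σ β := fun β => by
    have := hA β (-1)
    rw [hn] at this
    simpa using this.symm
  have hneg : ∀ β, σ (-β) = -σ β := fun β => by
    have := hA β 1
    rwa [hτ, h1, mul_one, mul_one] at this
  have hmul : ∀ β δ, σ (β * δ) = σ β * σ δ := fun β δ => by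
    have := hA β δ
    rw [hτ, hneg] at this
    exact neg_injective this
  have hone : ∀ a, σ (1 + a) = 1 + σ a := fun a => by
    -- The pairing is `a - (1 + a) = -1`. Adding `1` is thus respected, and multiplicativity
    -- upgrades this to full additivity.
    have := hm (conj a) (conj (-(1 + a))) 1 1 (by simp)
    rw [hτ, hτ, hneg, h1] at this
    linear_combination -this
  have hadd : ∀ a b, σ (a + b) = σ a + σ b := fun a b => by
    by_cases ha : a = 0
    · rw [ha, h0, zero_add, zero_add]
    · have e1 : a + b = a * (1 + b / a) := by field_simp
      have e2 : b = a * (b / a) := by field_simp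
      rw [e1, hmul, hone]
      conv_rhs => rw [e2, hmul]
      ring
  let s : ℂ →+* ℂ :=
    { toFun := σ, map_one' := h1, map_mul' := hmul, map_zero' := h0, map_add' := hadd }
  refine ⟨s, ?_, fun _ => rfl⟩
  -- Commuting with conjugation, `s` maps the reals to the reals, where the identity is the only
  -- ring endomorphism.
  have hre : ∀ r : ℝ, ((s r).re : ℂ) = s r := fun r => by
    rw [← Complex.conj_eq_iff_re]
    have := hτ r
    rwa [Complex.conj_ofReal] at this
  let ρ : ℝ →+* ℝ :=
    { toFun := fun r => (s r).re
      map_one' := by simp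
      map_zero' := by simp
      map_add' := fun x y => by simp
      map_mul' := fun x y => by
        apply Complex.ofReal_injective
        rw [hre, Complex.ofReal_mul, Complex.ofReal_mul, hre, hre, map_mul] }
  have hρ : ∀ r : ℝ, s r = r := fun r => by
    rw [← hre]
    exact congrArg _ (DFunLike.congr_fun (Subsingleton.elim ρ (RingHom.id ℝ)) r)
  let f : ℂ →ₐ[ℝ] ℂ := { s with commutes' := hρ }
  rcases Complex.real_algHom_eq_id_or_conj f with h | h
  · exact Or.inl (RingHom.ext fun c => DFunLike.congr_fun h c)
  · exact Or.inr (RingHom.ext fun c => DFunLike.congr_fun h c)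

/-! ### Rigidity of maps preserving the inner product values `0` and `-1`. -/

section Semilinear

variable {V W : Type*} [NormedAddCommGroup V] [InnerProductSpace ℂ V]
  [NormedAddCommGroup W] [InnerProductSpace ℂ W]

/-- A map preserving the relations `⟪x, y⟫ = 0` and `⟪x, y⟫ = -1` in both directions, as well as
linear dependence on pairs. -/
structure PairingPreserving (F : V → W) : Prop where
  zero_iff : ∀ x y, inner ℂ x y = 0 ↔ inner ℂ (F x) (F y) = 0
  neg_one_iff : ∀ x y, inner ℂ x y = -1 ↔ inner ℂ (F x) (F y) = -1
  span : ∀ (x y : V) (α β : ℂ), ∃ γ δ : ℂ, F (α • x + β • y) = γ • F x + δ • F y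

namespace PairingPreserving

variable {F : V → W}

theorem eq_zero_iff (hF : PairingPreserving F) {x : V} : F x = 0 ↔ x = 0 := by
  rw [← inner_self_eq_zero (𝕜 := ℂ), ← hF.zero_iff, inner_self_eq_zero]

theorem map_zero (hF : PairingPreserving F) : F 0 = 0 := hF.eq_zero_iff.2 rfl

theorem exists_smul (hF : PairingPreserving F) (c : ℂ) (x : V) : ∃ d : ℂ, F (c • x) = d • F x := by
  obtain ⟨γ, δ, h⟩ := hF.span x x c 0
  exact ⟨γ + δ, by rw [add_smul, ← h]; simp⟩

/-- The hypothesis says that `v` is the orthogonal projection of `u` onto the line of `v`. The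
vector `-v/‖v‖²` pairs to `-1` with both `v` and `u`, which expresses this through preserved
relations. -/
theorem inner_eq_normSq (hF : PairingPreserving F) {v u : V} (h : inner ℂ v u = (‖v‖ : ℂ) ^ 2) :
    inner ℂ (F v) (F u) = (‖F v‖ : ℂ) ^ 2 := by
  by_cases hv : v = 0
  · simp [hv, hF.map_zero]
  have hn : (‖v‖ : ℂ) ≠ 0 := by simpa using hv
  have hFn : (‖F v‖ : ℂ) ≠ 0 := by simpa [hF.eq_zero_iff] using hv
  obtain ⟨d, hd⟩ := hF.exists_smul (-((‖v‖ : ℂ) ^ 2)⁻¹) v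
  have h1 := (hF.neg_one_iff v (-((‖v‖ : ℂ) ^ 2)⁻¹ • v)).1 (by
    rw [inner_smul_right, inner_self_eq_norm_sq_to_K]; simp; field_simp)
  have h2 := (hF.neg_one_iff (-((‖v‖ : ℂ) ^ 2)⁻¹ • v) u).1 (by
    rw [inner_smul_left, h]; simp; field_simp)
  rw [hd, inner_smul_right, inner_self_eq_norm_sq_to_K] at h1
  have hd' : d = -((‖F v‖ : ℂ) ^ 2)⁻¹ := by
    have h1 : d * (‖F v‖ : ℂ) ^ 2 = -1 := h1
    field_simp
    linear_combination h1
  rw [hd, inner_smul_left, hd'] at h2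
  simp at h2
  field_simp at h2
  exact h2

/-- The sum projects to `v` and to `w`, so both coefficients of `F (v + w)` along `F v ⟂ F w` are
`1`. -/
theorem map_add_of_inner_eq_zero (hF : PairingPreserving F) {v w : V} (h : inner ℂ v w = 0) :
    F (v + w) = F v + F w := by
  by_cases hv : v = 0
  · simp [hv, hF.map_zero]
  by_cases hw : w = 0
  · simp [hw, hF.map_zero]
  have h' : inner ℂ w v = 0 := inner_eq_zero_symm.1 h
  obtain ⟨α, β, hαβ⟩ := hF.span v w 1 1
  rw [one_smul, one_smul] at hαβ
  have h1 := hF.inner_eq_normSq (v := v) (u := v + w)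
    (by rw [inner_add_right, h, inner_self_eq_norm_sq_to_K]; simp)
  have h2 := hF.inner_eq_normSq (v := w) (u := v + w)
    (by rw [inner_add_right, h', inner_self_eq_norm_sq_to_K]; simp)
  have hvn : (‖F v‖ : ℂ) ^ 2 ≠ 0 := by simpa [hF.eq_zero_iff] using hv
  have hwn : (‖F w‖ : ℂ) ^ 2 ≠ 0 := by simpa [hF.eq_zero_iff] using hw
  rw [hαβ, inner_add_right, inner_smul_right, inner_smul_right, (hF.zero_iff _ _).1 h,
    inner_self_eq_norm_sq_to_K, mul_zero, add_zero] at h1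
  rw [hαβ, inner_add_right, inner_smul_right, inner_smul_right, (hF.zero_iff _ _).1 h',
    inner_self_eq_norm_sq_to_K, mul_zero, zero_add] at h2
  rw [hαβ, mul_right_cancel₀ hvn (h1.trans (one_mul _).symm),
    mul_right_cancel₀ hwn (h2.trans (one_mul _).symm), one_smul, one_smul]

/-- `F (c • (v + w))` is proportional to `F v + F w`, so the factors on the two orthogonal
components agree. -/
theorem map_smul_of_inner_eq_zero (hF : PairingPreserving F) {v w : V} (hv : v ≠ 0) (h : inner ℂ v w = 0)
    {c d : ℂ} (hc : F (c • v) = d • F v) : F (c • w) = d • F w := by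
  by_cases hw : w = 0
  · simp [hw, hF.map_zero]
  obtain ⟨e, he⟩ := hF.exists_smul c w
  obtain ⟨k, hk⟩ := hF.exists_smul c (v + w)
  rw [smul_add, hF.map_add_of_inner_eq_zero (by rw [inner_smul_left, inner_smul_right, h, mul_zero, mul_zero]),
    hF.map_add_of_inner_eq_zero h, hc, he] at hk
  have h1 := (hF.zero_iff _ _).1 h
  have h2 := inner_eq_zero_symm.1 h1
  have hvn : (‖F v‖ : ℂ) ^ 2 ≠ 0 := by simpa [hF.eq_zero_iff] using hv
  have hwn : (‖F w‖ : ℂ) ^ 2 ≠ 0 := by simpa [hF.eq_zero_iff] using hw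
  have e1 := congrArg (inner ℂ (F v)) hk
  have e2 := congrArg (inner ℂ (F w)) hk
  simp only [inner_smul_right, inner_add_right, h1, h2, inner_self_eq_norm_sq_to_K, mul_zero,
    add_zero, zero_add] at e1 e2
  rw [he, mul_right_cancel₀ hvn e1, mul_right_cancel₀ hwn e2]

theorem norm_eq_one_of_orthonormal (hF : PairingPreserving F) {v w : V} (hv : ‖v‖ = 1) (hw : ‖w‖ = 1)
    (h : inner ℂ v w = 0) : ‖F v‖ = 1 ∧ F ((-1 : ℂ) • v) = (-1 : ℂ) • F v := by
  have hv0 : v ≠ 0 := fun h0 => by simp [h0] at hv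
  obtain ⟨s, hs⟩ := hF.exists_smul (-1) v
  have hs' := hF.map_smul_of_inner_eq_zero hv0 h hs
  have h1 := (hF.neg_one_iff v ((-1 : ℂ) • v)).1 (by
    rw [inner_smul_right, inner_self_eq_norm_sq_to_K, hv]; simp)
  have h2 := (hF.neg_one_iff w ((-1 : ℂ) • w)).1 (by
    rw [inner_smul_right, inner_self_eq_norm_sq_to_K, hw]; simp)
  have h' : inner ℂ w v = 0 := inner_eq_zero_symm.1 h
  -- Since `v + w ⟂ v - w`, one gets `‖F v‖² + s‖F w‖² = 0`; combined with `s‖F w‖² = -1 = s‖F v‖²`,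
  -- this gives `‖F v‖ = 1` and `s = -1`.
  have h3 := (hF.zero_iff (v + w) (v + (-1 : ℂ) • w)).1 (by
    simp [inner_add_left, h, h', inner_self_eq_norm_sq_to_K, hv, hw])
  rw [hF.map_add_of_inner_eq_zero h, hF.map_add_of_inner_eq_zero (by simp [h]), hs'] at h3
  rw [hs, inner_smul_right, inner_self_eq_norm_sq_to_K] at h1
  rw [hs', inner_smul_right, inner_self_eq_norm_sq_to_K] at h2
  simp only [inner_add_left, inner_add_right, inner_smul_right, (hF.zero_iff _ _).1 h,
    (hF.zero_iff _ _).1 h', inner_self_eq_norm_sq_to_K, add_zero, zero_add] at h3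
  rw [h2] at h3
  have h4 : (‖F v‖ : ℂ) ^ 2 = 1 := by linear_combination h3
  refine ⟨?_, ?_⟩
  · have : ‖F v‖ ^ 2 = 1 := by exact_mod_cast h4
    nlinarith [norm_nonneg (F v)]
  · rw [show s = -1 by rw [← h1]; erw [h4]; rw [mul_one]] at hs
    exact hs

/-- In dimension at least two, such a map is a linear or conjugate-linear isometry. -/
theorem exists_semilinear (hF : PairingPreserving F) (hd : ∀ x : V, ∃ w, w ≠ 0 ∧ inner ℂ x w = 0) :
    ∃ s : ℂ →+* ℂ, (s = RingHom.id ℂ ∨ s = starRingEnd ℂ) ∧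
      (∀ x y, F (x + y) = F x + F y) ∧ (∀ (c : ℂ) x, F (c • x) = s c • F x) ∧
      ∀ x, ‖F x‖ = ‖x‖ := by
  have hu : ∀ x : V, ∃ w, ‖w‖ = 1 ∧ inner ℂ x w = 0 := fun x => by
    obtain ⟨w, hw, hxw⟩ := hd x
    exact ⟨((‖w‖ : ℂ)⁻¹) • w, norm_smul_inv_norm hw, by rw [inner_smul_right, hxw, mul_zero]⟩
  obtain ⟨v, hv, -⟩ := hu 0
  obtain ⟨w, hw, hvw⟩ := hu v
  have hv0 : v ≠ 0 := fun h0 => by simp [h0] at hv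
  have hwv : inner ℂ w v = 0 := inner_eq_zero_symm.1 hvw
  have hFv0 : F v ≠ 0 := mt hF.eq_zero_iff.1 hv0
  choose σ hσ using fun c => hF.exists_smul c v
  have hσw : ∀ c, F (c • w) = σ c • F w := fun c => hF.map_smul_of_inner_eq_zero hv0 hvw (hσ c)
  obtain ⟨hFv, hneg⟩ := hF.norm_eq_one_of_orthonormal hv hw hvw
  obtain ⟨hFw, -⟩ := hF.norm_eq_one_of_orthonormal hw hv hwv
  have hpair : ∀ α β γ δ : ℂ, inner ℂ (α • v + β • w) (γ • v + δ • w) =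
      starRingEnd ℂ α * γ + starRingEnd ℂ β * δ := fun α β γ δ => by
    simp [hvw, hwv, inner_self_eq_norm_sq_to_K, hv, hw, mul_comm]
  have hFpair : ∀ α β γ δ : ℂ, inner ℂ (F (α • v + β • w)) (F (γ • v + δ • w)) =
      starRingEnd ℂ (σ α) * σ γ + starRingEnd ℂ (σ β) * σ δ := fun α β γ δ => by
    rw [hF.map_add_of_inner_eq_zero (by rw [inner_smul_left, inner_smul_right, hvw, mul_zero, mul_zero]),
      hF.map_add_of_inner_eq_zero (by rw [inner_smul_left, inner_smul_right, hvw, mul_zero, mul_zero]),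
      hσ, hσ, hσw, hσw]
    simp [(hF.zero_iff _ _).1 hvw, (hF.zero_iff _ _).1 hwv, inner_self_eq_norm_sq_to_K, hFv, hFw,
      mul_comm]
  obtain ⟨s, hs, hσs⟩ := exists_ringHom_of_pairing_preserving (σ := σ)
    (by
      have := hσ 0
      rw [zero_smul, hF.map_zero, eq_comm, smul_eq_zero] at this
      exact this.resolve_right hFv0)
    (by
      have := hσ 1
      rw [one_smul] at this
      exact smul_left_injective ℂ hFv0 (by simpa using this.symm))
    (smul_left_injective ℂ hFv0 ((hσ _).symm.trans hneg))
    (fun α β γ δ h => by rw [← hFpair, ← hF.zero_iff, hpair, h])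
    (fun α β γ δ h => by rw [← hFpair, ← hF.neg_one_iff, hpair, h])
  have hsmul : ∀ (c : ℂ) p, F (c • p) = s c • F p := fun c p => by
    have hr : inner ℂ v (p - inner ℂ v p • v) = 0 := by
      rw [inner_sub_right, inner_smul_right, inner_self_eq_norm_sq_to_K, hv]; simp
    have hp : p = inner ℂ v p • v + (p - inner ℂ v p • v) := by abel
    generalize inner ℂ v p = α at hr hp
    generalize p - α • v = r at hr hp
    have hr' := hF.map_smul_of_inner_eq_zero hv0 hr (hσ c)
    rw [hp, smul_add, hF.map_add_of_inner_eq_zero (by simp [hr]),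
      hF.map_add_of_inner_eq_zero (by simp [hr]), hr', smul_smul, hσ, hσ,
      hσs, hσs, hσs, map_mul, smul_add, smul_smul]
  refine ⟨s, hs, fun p q => ?_, hsmul, fun p => ?_⟩
  -- Additivity on a general pair: split `q` into a multiple of `p` and a vector orthogonal to `p`,
  -- so only homogeneity and orthogonal additivity are needed.
  · by_cases hp : p = 0
    · simp [hp, hF.map_zero]
    have hpn : (‖p‖ : ℂ) ≠ 0 := by simpa using hp
    set α : ℂ := inner ℂ p q / (‖p‖ : ℂ) ^ 2 with hα
    have hr : inner ℂ p (q - α • p) = 0 := by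
      rw [inner_sub_right, inner_smul_right, inner_self_eq_norm_sq_to_K, hα]
      simp; field_simp; simp
    have hq : q = α • p + (q - α • p) := by abel
    clear_value α
    generalize q - α • p = r at hr hq
    have e : p + q = (1 + α) • p + r := by rw [hq]; module
    rw [e, hq, hF.map_add_of_inner_eq_zero (by rw [inner_smul_left, hr, mul_zero]),
      hF.map_add_of_inner_eq_zero (by rw [inner_smul_left, hr, mul_zero]), hsmul, hsmul, map_add,
      map_one]
    module
  · by_cases hp : p = 0
    · simp [hp, hF.map_zero]
    have hpn : (‖p‖ : ℂ) ≠ 0 := by simpa using hp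
    obtain ⟨q, hq, hpq⟩ := hu p
    have hu1 : ‖((‖p‖ : ℂ)⁻¹) • p‖ = 1 := norm_smul_inv_norm hp
    have hn := (hF.norm_eq_one_of_orthonormal hu1 hq (by rw [inner_smul_left, hpq, mul_zero])).1
    have e : p = (‖p‖ : ℂ) • ((‖p‖ : ℂ)⁻¹) • p := by rw [smul_smul, mul_inv_cancel₀ hpn, one_smul]
    have hns : ‖s (‖p‖ : ℂ)‖ = ‖p‖ := by rcases hs with rfl | rfl <;> simp
    conv_lhs => rw [e, hsmul, norm_smul, hn, mul_one, hns]

end PairingPreserving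

end Semilinear

/-! ### Uhlhorn's theorem by means of an affine chart. -/

section Orthogonality

variable {H : Type*} [NormedAddCommGroup H] [InnerProductSpace ℂ H]

/-- Orthogonality-preserving maps preserve linear dependence on pairs. -/
theorem exists_eq_smul_add_smul_of_orthogonality_preserving {g : H → H}
    (horth : ∀ x y, inner ℂ x y = 0 ↔ inner ℂ (g x) (g y) = 0)
    (hsurj : ∀ y, ∃ x, ∃ c : ℂ, y = c • g x) (x y : H) (α β : ℂ) :
    ∃ γ δ : ℂ, g (α • x + β • y) = γ • g x + δ • g y := by
  have : FiniteDimensional ℂ (Submodule.span ℂ ({g x, g y} : Set H)) :=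
    FiniteDimensional.span_of_finite ℂ (Set.toFinite _)
  have hmem : g (α • x + β • y) ∈ Submodule.span ℂ ({g x, g y} : Set H) := by
    -- The finite-dimensional span is its own double orthocomplement, and orthogonality to it can be
    -- tested on multiples of values of `g`.
    rw [← Submodule.orthogonal_orthogonal (Submodule.span ℂ ({g x, g y} : Set H)),
      Submodule.mem_orthogonal']
    intro w hw
    rw [Submodule.mem_orthogonal] at hw
    have h1 := hw (g x) (Submodule.subset_span (by simp))
    have h2 := hw (g y) (Submodule.subset_span (by simp))
    obtain ⟨u, c, rfl⟩ := hsurj w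
    by_cases hc : c = 0
    · simp [hc]
    rw [inner_smul_right, mul_eq_zero, or_iff_right hc, ← horth] at h1 h2
    rw [inner_smul_right, (horth _ _).1, mul_zero]
    rw [inner_add_left, inner_smul_left, inner_smul_left, h1, h2, mul_zero, mul_zero, add_zero]
  obtain ⟨γ, δ, h⟩ := Submodule.mem_span_pair.1 hmem
  exact ⟨γ, δ, h.symm⟩

/-- **Uhlhorn's theorem**: a map of vectors preserving orthogonality in both directions and onto
up to scalars is, up to scalars, a linear or conjugate-linear surjective isometry. -/
theorem exists_isometry_of_orthogonality_preserving
    (hdim : ∀ x y : H, ∃ w, w ≠ 0 ∧ inner ℂ x w = 0 ∧ inner ℂ y w = 0) {g : H → H}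
    (horth : ∀ x y, inner ℂ x y = 0 ↔ inner ℂ (g x) (g y) = 0)
    (hsurj : ∀ y, ∃ x, ∃ c : ℂ, y = c • g x) :
    ∃ s : ℂ →+* ℂ, (s = RingHom.id ℂ ∨ s = starRingEnd ℂ) ∧
      ∃ U : H →ₛₗᵢ[s] H, Function.Surjective U ∧ ∀ x, ∃ c : ℂ, U x = c • g x := by
  have hspan := exists_eq_smul_add_smul_of_orthogonality_preserving horth hsurj
  have hg0 : ∀ x, g x = 0 ↔ x = 0 := fun x => by
    rw [← inner_self_eq_zero (𝕜 := ℂ), ← horth, inner_self_eq_zero]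
  obtain ⟨a, ha⟩ : ∃ a : H, ‖a‖ = 1 := by
    obtain ⟨w, hw, -, -⟩ := hdim 0 0
    exact ⟨((‖w‖ : ℂ)⁻¹) • w, norm_smul_inv_norm hw⟩
  have ha0 : a ≠ 0 := fun h => by simp [h] at ha
  have haa : inner ℂ a a = (1 : ℂ) := by rw [inner_self_eq_norm_sq_to_K, ha]; simp
  have hga : g a ≠ 0 := mt (hg0 a).1 ha0
  obtain ⟨n, hn0, b, hb, hgb⟩ : ∃ n : ℂ, n ≠ 0 ∧ ∃ b : H, ‖b‖ = 1 ∧ g a = n • b :=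
    ⟨‖g a‖, by simpa using hga, ((‖g a‖ : ℂ)⁻¹) • g a, norm_smul_inv_norm hga, by
      rw [smul_smul, mul_inv_cancel₀ (by simpa using hga), one_smul]⟩
  have hbb : inner ℂ b b = (1 : ℂ) := by rw [inner_self_eq_norm_sq_to_K, hb]; simp
  have hbg : ∀ x, inner ℂ b (g x) = 0 ↔ inner ℂ a x = 0 := fun x => by
    rw [horth a x, hgb, inner_smul_left, mul_eq_zero, or_iff_right (by simpa using hn0)]
  let V : Submodule ℂ H := (ℂ ∙ a)ᗮ
  have hV : ∀ {x : H}, x ∈ V ↔ inner ℂ a x = 0 := Submodule.mem_orthogonal_singleton_iff_inner_right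
  have haV : ∀ v : V, inner ℂ a (v : H) = 0 := fun v => hV.1 v.2
  have hVa : ∀ v : V, inner ℂ (v : H) a = 0 := fun v => inner_eq_zero_symm.1 (haV v)
  -- The scalar that makes the `b`-component of `g (a + v)` equal to `1`, so that the multiple has
  -- the form `b + F v`.
  let k : V → ℂ := fun v => (inner ℂ b (g (a + v)))⁻¹
  have hk' : ∀ v : V, inner ℂ b (g (a + v)) ≠ 0 := fun v => by
    rw [Ne, hbg, inner_add_right, haV, haa]; simp
  have hk : ∀ v, k v ≠ 0 := fun v => inv_ne_zero (hk' v)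
  let F : V → H := fun v => k v • g (a + v) - b
  have hG : ∀ v, b + F v = k v • g (a + v) := fun v => add_sub_cancel _ _
  have hbF : ∀ v, inner ℂ b (F v) = 0 := fun v => by
    change inner ℂ b (k v • g (a + v) - b) = 0
    rw [inner_sub_right, inner_smul_right, hbb, inv_mul_cancel₀ (hk' v), sub_self]
  have hFb : ∀ v, inner ℂ (F v) b = 0 := fun v => inner_eq_zero_symm.1 (hbF v)
  have hneg : ∀ x y : V, inner ℂ x y = -1 ↔ inner ℂ (F x) (F y) = -1 := fun x y => by
    have e1 : inner ℂ (a + (x : H)) (a + (y : H)) = 1 + inner ℂ x y := by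
      simp only [inner_add_left, inner_add_right, haa, haV, hVa, Submodule.coe_inner]; ring
    have e2 : inner ℂ (b + F x) (b + F y) = 1 + inner ℂ (F x) (F y) := by
      simp only [inner_add_left, inner_add_right, hbb, hbF, hFb]; ring
    have e3 : inner ℂ (b + F x) (b + F y) = 0 ↔ inner ℂ (a + (x : H)) (a + (y : H)) = 0 := by
      rw [hG, hG, inner_smul_left, inner_smul_right, horth (a + x) (a + y)]
      simp [hk]
    rw [e1, e2] at e3
    rw [eq_neg_iff_add_eq_zero, eq_neg_iff_add_eq_zero, add_comm, ← e3, add_comm]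
  -- `g (a + v)` lies in the span of `g a` and `g v`, and `F v ⟂ b` removes the first direction. For
  -- `v ≠ 0`, pairing with `-v/‖v‖²` excludes `t = 0`.
  have hFg : ∀ v : V, ∃ t : ℂ, t ≠ 0 ∧ F v = t • g v := fun v => by
    obtain ⟨γ, δ, h⟩ := hspan a v 1 1
    rw [one_smul, one_smul] at h
    have hb' := hbF v
    have hgv : inner ℂ b (g v) = 0 := (hbg _).2 (haV v)
    have e : F v = (k v * γ * n - 1) • b + (k v * δ) • g v := by
      change k v • g (a + v) - b = _
      rw [h, hgb]; module
    rw [e, inner_add_right, inner_smul_right, inner_smul_right, hbb, hgv, mul_zero, add_zero,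
      mul_one] at hb'
    rw [hb', zero_smul, zero_add] at e
    by_cases hv : v = 0
    · refine ⟨1, one_ne_zero, ?_⟩
      rw [e, hv, Submodule.coe_zero, (hg0 0).2 rfl, smul_zero, smul_zero]
    refine ⟨_, fun h0 => ?_, e⟩
    rw [h0, zero_smul] at e
    have hn : (‖v‖ : ℂ) ≠ 0 := by simpa using hv
    have := (hneg v (-((‖v‖ : ℂ) ^ 2)⁻¹ • v)).1 (by
      rw [inner_smul_right, inner_self_eq_norm_sq_to_K, neg_mul]
      exact congrArg Neg.neg (inv_mul_cancel₀ (pow_ne_zero 2 hn)))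
    rw [e, inner_zero_left] at this
    simp at this
  have hF : PairingPreserving F := by
    refine ⟨fun x y => ?_, hneg, fun x y α β => ?_⟩
    · obtain ⟨t, ht, hx⟩ := hFg x
      obtain ⟨t', ht', hy⟩ := hFg y
      rw [hx, hy, inner_smul_left, inner_smul_right, Submodule.coe_inner, horth x y]
      simp [ht, ht']
    · obtain ⟨t, ht, hx⟩ := hFg x
      obtain ⟨t', ht', hy⟩ := hFg y
      obtain ⟨t'', -, hz⟩ := hFg (α • x + β • y)
      obtain ⟨γ, δ, h⟩ := hspan x y α β
      refine ⟨t'' * γ * t⁻¹, t'' * δ * t'⁻¹, ?_⟩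
      rw [hz, hx, hy, smul_smul, smul_smul, inv_mul_cancel_right₀ ht, inv_mul_cancel_right₀ ht',
        mul_smul, mul_smul, ← smul_add, ← h]
      rfl
  -- Dimension at least three leaves, in the complement of `a`, a nonzero vector orthogonal to any
  -- given `x`.
  obtain ⟨s, hs, hadd, hsmul, hnorm⟩ := hF.exists_semilinear fun x => by
    obtain ⟨w, hw, haw, hxw⟩ := hdim a x
    exact ⟨⟨w, hV.2 haw⟩, by simpa [Subtype.ext_iff] using hw, hxw⟩
  let π : H → V := fun x => ⟨x - inner ℂ a x • a, hV.2 (by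
    rw [inner_sub_right, inner_smul_right, haa, mul_one, sub_self])⟩
  have hπ : ∀ x, x = inner ℂ a x • a + (π x : H) := fun x => (add_sub_cancel _ _).symm
  have hpyth : ∀ (c : ℂ) (e z : H), ‖e‖ = 1 → inner ℂ e z = 0 →
      ‖c • e + z‖ * ‖c • e + z‖ = ‖c‖ * ‖c‖ + ‖z‖ * ‖z‖ := fun c e z he hz => by
    rw [norm_add_sq_eq_norm_sq_add_norm_sq_of_inner_eq_zero (𝕜 := ℂ) _ _
      (by rw [inner_smul_left, hz, mul_zero]), norm_smul, he, mul_one]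
  let U : H →ₛₗᵢ[s] H :=
    { toFun := fun x => s (inner ℂ a x) • b + F (π x)
      map_add' := fun x y => by
        have : π (x + y) = π x + π y := Subtype.ext <| by
          simp only [π, inner_add_right, Submodule.coe_add]; module
        rw [this, hadd, inner_add_right, map_add]; module
      map_smul' := fun c x => by
        have : π (c • x) = c • π x := Subtype.ext <| by
          simp only [π, inner_smul_right, Submodule.coe_smul]; module
        rw [this, hsmul, inner_smul_right, map_mul]; module
      norm_map' := fun x => by
        change ‖s (inner ℂ a x) • b + F (π x)‖ = ‖x‖
        have hns : ‖s (inner ℂ a x)‖ = ‖inner ℂ a x‖ := by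
          rcases hs with rfl | rfl
          · rfl
          · exact RCLike.norm_conj _
        refine (mul_self_inj (norm_nonneg _) (norm_nonneg _)).1 ?_
        rw [hpyth _ _ _ hb (hbF _), hnorm, hns]
        conv_rhs => rw [hπ x, hpyth _ _ _ ha (haV _)]
        rfl }
  have hU : ∀ x, U x = s (inner ℂ a x) • b + F (π x) := fun _ => rfl
  have hUg : ∀ x, ∃ c : ℂ, U x = c • g x := fun x => by
    by_cases hx : inner ℂ a x = 0
    · obtain ⟨t, -, ht⟩ := hFg (π x)
      have e := hπ x
      rw [hx, zero_smul, zero_add] at e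
      exact ⟨t, by rw [hU, hx, map_zero, zero_smul, zero_add, ht, ← e]⟩
    -- Rescaling by `c⁻¹` puts `x` into the chart `a + V`, where `b + F` is a multiple of `g` by
    -- construction.
    · set c := inner ℂ a x with hc
      obtain ⟨γ, δ, h⟩ := hspan x 0 c⁻¹ 0
      rw [smul_zero, add_zero, (hg0 0).2 rfl, smul_zero, add_zero] at h
      have e : c⁻¹ • x = a + ((c⁻¹ • π x : V) : H) := by
        conv_lhs => rw [hπ x, smul_add, smul_smul, ← hc, inv_mul_cancel₀ hx, one_smul]
        rfl
      have e2 : π x = c • c⁻¹ • π x := by rw [smul_smul, mul_inv_cancel₀ hx, one_smul]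
      refine ⟨s c * (k (c⁻¹ • π x) * γ), ?_⟩
      rw [hU, ← hc, congrArg F e2, hsmul, ← smul_add, hG, ← e, h, mul_smul, mul_smul]
  refine ⟨s, hs, U, fun y => ?_, hUg⟩
  obtain ⟨x, c, rfl⟩ := hsurj y
  by_cases hx : x = 0
  · exact ⟨0, by rw [hx, (hg0 0).2 rfl, smul_zero, map_zero]⟩
  obtain ⟨d, hd⟩ := hUg x
  have hd0 : d ≠ 0 := fun h0 => hx (by
    rw [h0, zero_smul] at hd
    simpa [hd] using (U.norm_map x).symm)
  have hss : ∀ z, ∃ z', s z' = z := fun z => by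
    rcases hs with rfl | rfl
    · exact ⟨z, rfl⟩
    · exact ⟨starRingEnd ℂ z, Complex.conj_conj z⟩
  obtain ⟨z, hz⟩ := hss (c * d⁻¹)
  exact ⟨z • x, by rw [U.map_smulₛₗ, hz, hd, smul_smul, inv_mul_cancel_right₀ hd0]⟩

end Orthogonality
-- From lines back to all projections.
/-- If `φ` preserves commutativity and acts on lines as the semilinear isometry `U`, then it
acts as conjugation by `U` up to complements. -/
theorem eq_isometryConj_or_perp {H : Type*} [NormedAddCommGroup H] [InnerProductSpace ℂ H]
    [CompleteSpace H] {σ τ : ℂ →+* ℂ} [RingHomInvPair σ τ] [RingHomInvPair τ σ]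
    (U : H ≃ₛₗᵢ[σ] H) {φ : Proj H → Proj H}
    (hcomm : ∀ P Q : Proj H, Commute P.1 Q.1 ↔ Commute (φ P).1 (φ Q).1) {g : H → H}
    (hg : ∀ x, Proj.SameCommutant (φ (Proj.line x)) (Proj.line (g x)))
    (hU : ∀ x, ∃ c : ℂ, U x = c • g x) (P : Proj H) :
    (φ P).1 = isometryConj U P.1 ∨ (φ P).1 = isometryConj U P.perp.1 := by
  -- Killing or fixing a vector is commutation with its line, which `φ` preserves. Complements and
  -- the scalar relating `U x` to `g x` do not matter here.
  have key : ∀ x, (P.1 x = 0 ∨ P.1 x = x) ↔ ((φ P).1 (U x) = 0 ∨ (φ P).1 (U x) = U x) := by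
    intro x
    by_cases hx : x = 0
    · simp [hx]
    obtain ⟨c, hc⟩ := hU x
    have hc0 : c ≠ 0 := fun h0 => hx (by
      rw [h0, zero_smul] at hc
      exact (map_eq_zero_iff U U.injective).1 hc)
    rw [← Proj.commute_line_iff, hcomm, hg x, Proj.commute_line_iff, hc, map_smul,
      smul_eq_zero_iff_right hc0, smul_right_inj hc0]
  have h := eq_or_eq_compl_of_killed_or_fixed_iff
    (P := (isometryConj U P.1 : H →ₗ[ℂ] H)) (S := ((φ P).1 : H →ₗ[ℂ] H))
    (fun x => by simp [isometryConj_apply, P.apply_apply]) (φ P).apply_apply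
    (fun y => by
      obtain ⟨x, rfl⟩ := U.surjective y
      rw [ContinuousLinearMap.coe_coe, ContinuousLinearMap.coe_coe, isometryConj_apply,
        U.symm_apply_apply, map_eq_zero_iff U U.injective, U.injective.eq_iff]
      exact key x)
  refine h.imp (fun h => ContinuousLinearMap.ext h) fun h => ContinuousLinearMap.ext fun x => ?_
  refine (h x).trans ?_
  rw [ContinuousLinearMap.coe_coe, isometryConj_apply, isometryConj_apply, Proj.perp_apply,
    map_sub, U.apply_symm_apply]

theorem theorem4p3 {H : Type*} [NormedAddCommGroup H] [InnerProductSpace ℂ H] [CompleteSpace H]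
    (hdim : 3 ≤ Module.rank ℂ H) (φ : Proj H → Proj H) (hbij : Function.Bijective φ)
    (hcomm : ∀ P Q : Proj H,
      P.1 * Q.1 = Q.1 * P.1 ↔ (φ P).1 * (φ Q).1 = (φ Q).1 * (φ P).1) :
    (∃ U : H ≃ₗᵢ[ℂ] H, ∀ P : Proj H,
      (φ P).1 = isometryConj U P.1 ∨ (φ P).1 = isometryConj U P.perp.1) ∨
    (∃ U : H ≃ₗᵢ⋆[ℂ] H, ∀ P : Proj H,
      (φ P).1 = isometryConj U P.1 ∨ (φ P).1 = isometryConj U P.perp.1) := by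
  have hdim' := exists_ne_zero_orthogonal hdim
  obtain ⟨g, hg, horth, hsurj⟩ := exists_orthogonality_preserving hdim' hbij.2 hcomm
  obtain ⟨s, hs, U, hU, hUg⟩ := exists_isometry_of_orthogonality_preserving hdim' horth hsurj
  rcases hs with rfl | rfl
  · exact Or.inl ⟨LinearIsometryEquiv.ofSurjective U hU, fun P =>
      eq_isometryConj_or_perp _ hcomm hg hUg P⟩
  · exact Or.inr ⟨LinearIsometryEquiv.ofSurjective U hU, fun P =>
      eq_isometryConj_or_perp _ hcomm hg hUg P⟩
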